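/- A topological space is *quasi-Polish* if it is countably based and its topology is generated by the balls $\{y : d(x,y)<\varepsilon\}$ of a Smyth-complete quasi-metric $d$. (Here a quasi-metric is a function $d\colon X\times X\to[0,\infty)$ with $d(x,z)\le d(x,y)+d(y,z)$ and $x=y \iff d(x,y)=d(y,x)=0$; it is Smyth-complete if every sequence $(x_n)$ such that for each $\varepsilon>0$ there is $N$ with $d(x_n,x_m)<\varepsilon$ for all $m\ge n\ge N$ converges for the metric $\max\{d(x,y),d(y,x)\}$.) For a topological space $X$ let - $\mathbf{O}(X)$ be the lattice of open subsets of $X$, ordered by inclusion, with the Scott topology; - $\mathbf{A}(X)$ be the set of closed subsets of $X$ with the lower Vietoris topology, generated by the sets $\Diamond U=\{A\in\mathbf{A}(X) : A\cap U\neq\emptyset\}$ for $U\subseteq X$ open; - $\mathbf{K}(X)$ be the set of compact saturated subsets of $X$ with the upper Vietoris topology, generated by the sets $\Box U=\{K\in\mathbf{K}(X) : K\subseteq U\}$ for $U\subseteq X$ open, where a set is saturated if it is the intersection of its open neighbourhoods. For a continuous map $f\colon X\to Y$ let $\mathbf{O}(f)\colon\mathbf{O}(Y)\to\mathbf{O}(X)$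 be $U\mapsto f^{-1}(U)$, let $\mathbf{A}(f)\colon\mathbf{A}(X)\to\mathbf{A}(Y)$ send $A$ to the closure of $f(A)$, and let $\mathbf{K}(f)\colon\mathbf{K}(X)\to\mathbf{K}(Y)$ send $K$ to the saturation of $f(K)$ (the intersection of its open neighbourhoods). **Theorem.** For every quasi-Polish space $X$ the maps $$\gamma_X\colon \mathbf{K}(\mathbf{O}(X))\to\mathbf{O}(\mathbf{A}(X)),\quad \gamma_X(\mathfrak{K})=\bigcap_{U\in\mathfrak{K}}\Diamond U,$$ $$\delta_X\colon \mathbf{O}(\mathbf{A}(X))\to\mathbf{K}(\mathbf{O}(X)),\quad \delta_X(\mathcal{U})=\{U\in\mathbf{O}(X) : \mathcal{U}\subseteq\Diamond U\},$$ are well defined, continuous and inverse to each other; in particular $\mathbf{K}(\mathbf{O}(X))$ with the upper Vietoris topology is homeomorphic to $\mathbf{O}(\mathbf{A}(X))$ with the Scott topology. Moreover they are natural in $X$: for every continuous map $f\colon X\to Y$ between quasi-Polish spaces, $$\gamma_X\circ\mathbf{K}(\mathbf{O}(f))=\mathbf{O}(\mathbf{A}(f))\circ\gamma_Y \quad\text{and}\quad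 \delta_X\circ\mathbf{O}(\mathbf{A}(f))=\mathbf{K}(\mathbf{O}(f))\circ\delta_Y .$$ -/

import Mathlib

open TopologicalSpace Topology

universe u

/-- `d` is a quasi-metric: nonnegative, satisfying the (directed) triangle inequality, and
`x = y` iff `d x y = 0` and `d y x = 0`. Symmetry is not required. -/
structure IsQuasiMetric {X : Type*} (d : X → X → ℝ) : Prop where
  nonneg : ∀ x y, 0 ≤ d x y
  eq_iff : ∀ x y, x = y ↔ d x y = 0 ∧ d y x = 0
  triangle : ∀ x y z, d x z ≤ d x y + d y z

/-- A sequence is (forward, or left K-) Cauchy for `d` if for every `ε > 0` there is `N` with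
`d (u n) (u m) < ε` whenever `N ≤ n ≤ m`. -/
def IsQuasiCauchy {X : Type*} (d : X → X → ℝ) (u : ℕ → X) : Prop :=
  ∀ ε > 0, ∃ N, ∀ n m, N ≤ n → n ≤ m → d (u n) (u m) < ε

/-- `d` is Smyth-complete if every Cauchy sequence converges with respect to the symmetrized
metric `max (d x y) (d y x)`. -/
def IsSmythComplete {X : Type*} (d : X → X → ℝ) : Prop :=
  ∀ u : ℕ → X, IsQuasiCauchy d u →
    ∃ x, ∀ ε > 0, ∃ N, ∀ n, N ≤ n → max (d x (u n)) (d (u n) x) < ε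

/-- A space is quasi-Polish if it is countably based and its topology is the one induced by a
Smyth-complete quasi-metric `d`, i.e. the one generated by the balls `{y | d x y < ε}`. -/
class QuasiPolishSpace (X : Type*) [TopologicalSpace X] : Prop
    extends SecondCountableTopology X where
  exists_quasiMetric : ∃ d : X → X → ℝ, IsQuasiMetric d ∧ IsSmythComplete d ∧
    ‹TopologicalSpace X› =
      TopologicalSpace.generateFrom {B | ∃ (x : X) (ε : ℝ), 0 < ε ∧ B = {y | d x y < ε}}

/-! ### The open set lattice with the Scott topology -/

/-- `O(X)`: the lattice of open subsets of `X`, ordered by inclusion, with the Scott topology. -/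
abbrev OpenLattice (X : Type*) [TopologicalSpace X] : Type _ := WithScott (Opens X)

/-- The underlying set of points of an element of `O(X)`. -/
def OpenLattice.toSet {X : Type*} [TopologicalSpace X] (U : OpenLattice X) : Set X :=
  (WithScott.ofScott U : Opens X)

/-- The action of the contravariant functor `O` on a continuous map: `O(f)(U) = f⁻¹(U)`. -/
def OpenLattice.map {X Y : Type*} [TopologicalSpace X] [TopologicalSpace Y] (f : C(X, Y)) :
    C(OpenLattice Y, OpenLattice X) where
  toFun U := WithScott.toScott (Opens.comap f (WithScott.ofScott U))
  continuous_toFun := by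
    rw [← IsScott.scottContinuousOn_iff_continuous (D := Set.univ) (fun _ _ _ => Set.mem_univ _)]
    intro (D : Set (Opens Y)) _ _ _ (a : Opens Y) (ha : IsLUB D a)
    have h2 : a = sSup D := ha.unique (isLUB_sSup D)
    subst h2
    have h1 : Opens.comap f (sSup D) = sSup (Opens.comap f '' D) := by
      rw [map_sSup]
    change IsLUB (α := Opens X) (Opens.comap f '' D) (Opens.comap f (sSup D))
    rw [h1]
    exact isLUB_sSup _

/-! ### The lower powerspace -/

/-- The set of closed subsets of `X`, the carrier of the lower powerspace `A(X)`. -/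
def LowerPowerspace (X : Type*) [TopologicalSpace X] : Type _ := Closeds X

namespace LowerPowerspace

instance (X : Type*) [TopologicalSpace X] : SetLike (LowerPowerspace X) X :=
  inferInstanceAs (SetLike (Closeds X) X)

/-- `◇ U = {A ∈ A(X) | A ∩ U ≠ ∅}`. -/
def diamond {X : Type*} [TopologicalSpace X] (U : Set X) : Set (LowerPowerspace X) :=
  {A | ((A : Set X) ∩ U).Nonempty}

/-- The lower Vietoris topology, generated by the sets `◇ U` for `U` open. -/
instance (X : Type*) [TopologicalSpace X] : TopologicalSpace (LowerPowerspace X) :=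
  TopologicalSpace.generateFrom {W | ∃ U : Set X, IsOpen U ∧ W = diamond U}

/-- The action of the functor `A` on a continuous map: `A(f)(A)` is the closure of `f(A)`. -/
def map {X Y : Type*} [TopologicalSpace X] [TopologicalSpace Y] (f : C(X, Y)) :
    C(LowerPowerspace X, LowerPowerspace Y) where
  toFun A := Closeds.closure (f '' (A : Set X))
  continuous_toFun := by
    refine continuous_generateFrom_iff.2 ?_
    rintro _ ⟨U, hU, rfl⟩
    refine TopologicalSpace.isOpen_generateFrom_of_mem ⟨f ⁻¹' U, hU.preimage f.continuous, ?_⟩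
    ext A
    change (closure (f '' (A : Set X)) ∩ U).Nonempty ↔ ((A : Set X) ∩ f ⁻¹' U).Nonempty
    rw [closure_inter_open_nonempty_iff hU, Set.image_inter_nonempty_iff]

end LowerPowerspace

/-! ### The upper powerspace -/

/-- The set of compact saturated subsets of `X`, the carrier of the upper powerspace `K(X)`.
Here `nhdsKer K` is the intersection of all open sets containing `K`. -/
structure UpperPowerspace (X : Type*) [TopologicalSpace X] where
  carrier : Set X
  isCompact : IsCompact carrier
  saturated : nhdsKer carrier = carrier

namespace UpperPowerspace

instance (X : Type*) [TopologicalSpace X] : SetLike (UpperPowerspace X) X where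
  coe := UpperPowerspace.carrier
  coe_injective := by
    rintro ⟨K, _, _⟩ ⟨L, _, _⟩ h
    congr

/-- `□ U = {K ∈ K(X) | K ⊆ U}`. -/
def box {X : Type*} [TopologicalSpace X] (U : Set X) : Set (UpperPowerspace X) :=
  {K | (K : Set X) ⊆ U}

/-- The upper Vietoris topology, generated by the sets `□ U` for `U` open. -/
instance (X : Type*) [TopologicalSpace X] : TopologicalSpace (UpperPowerspace X) :=
  TopologicalSpace.generateFrom {W | ∃ U : Set X, IsOpen U ∧ W = box U}

/-- The action of the functor `K` on a continuous map: `K(f)(K)` is the saturation of `f(K)`. -/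
def map {X Y : Type*} [TopologicalSpace X] [TopologicalSpace Y] (f : C(X, Y)) :
    C(UpperPowerspace X, UpperPowerspace Y) where
  toFun K :=
    { carrier := nhdsKer (f '' (K : Set X))
      isCompact := by
        have h : IsCompact (f '' (K : Set X)) := K.isCompact.image f.continuous
        rw [isCompact_iff_finite_subcover] at h ⊢
        intro ι U hU hc
        obtain ⟨t, ht⟩ := h U hU (subset_nhdsKer.trans hc)
        exact ⟨t, nhdsKer_minimal ht (isOpen_biUnion fun i _ => hU i)⟩
      saturated := nhdsKer_nhdsKer _ }
  continuous_toFun := by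
    refine continuous_generateFrom_iff.2 ?_
    rintro _ ⟨U, hU, rfl⟩
    refine TopologicalSpace.isOpen_generateFrom_of_mem ⟨f ⁻¹' U, hU.preimage f.continuous, ?_⟩
    ext K
    change nhdsKer (f '' (K : Set X)) ⊆ U ↔ (K : Set X) ⊆ f ⁻¹' U
    rw [hU.nhdsKer_subset, Set.image_subset_iff]

end UpperPowerspace

/-!
That `γ` and `δ` are inverse to each other is formal: a compact saturated set `𝔎` of opens is an
upper set and an open set `𝒰` of closed sets is an upper set for inclusion, so both can be tested
against complements (`upperOpenHomeomorph`). Naturality is formal as well. The content lies in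
well-definedness and continuity.

A basic open set `⋂ V ∈ F, ◇ V` with `F` finite lies in `◇ U` iff some `V ∈ F` lies in `U`
(`diamondInter_subset_diamond`). Hence `δ 𝒰` is an intersection of finitely generated upper sets
`↑F i`. Such an intersection is the upper closure of the set of suprema of selections from the
compact product `∏ i, F i`, and taking suprema is Scott-continuous; this makes `δ 𝒰` compact
(`isCompact_setOf_forall_exists_le`), and the same compactness, in the form of
`exists_finset_setOf_forall_exists_le_subset`, makes `δ` continuous.

For `γ 𝔎` to be open, each closed `A` that meets all members of `𝔎` must meet finitely many opens
such that each member of `𝔎` contains one of them. If `X` is second countable and this fails, a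
cluster point of a sequence of counterexamples in `𝔎` leads to a convergent sequence that
contradicts it (`exists_finset_forall_exists_le`).

Continuity of `γ` rests on consonance of the lower powerspace: every Scott-open set of opens is a
union of sets `{V | C ⊆ V}` with `C` compact. Consonance follows by Kőnig's lemma from a
convergent base (`IsConvergentBase.exists_isCompact`). The formal balls of a Smyth-complete
quasi-metric are such a base (`IsSmythComplete.exists_isConvergentBase`), and the finite sets of
elements of a convergent base of `X` give one of the lower powerspace
(`IsConvergentBase.lowerPowerspace`).
-/

open Set Filter

/-! ### Scott-open sets of complete lattices -/

section Scott

variable {α ι : Type*} [CompleteLattice α]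

/-- A Scott-open set containing the supremum of a family contains a finite subsupremum. -/
theorem IsOpen.exists_finset_sup_mem {W : Set (WithScott α)} (hW : IsOpen W) {s : Set ι}
    {f : ι → α} (h : WithScott.toScott (⨆ i ∈ s, f i) ∈ W) :
    ∃ t : Finset ι, ↑t ⊆ s ∧ WithScott.toScott (t.sup f) ∈ W := by
  classical
  have hW' := (IsScott.isOpen_iff_isUpperSet_and_dirSupInaccOn (D := univ)).1 hW
  let d : Set α := {a | ∃ t : Finset ι, ↑t ⊆ s ∧ t.sup f = a}
  have hne : d.Nonempty := ⟨_, ∅, by simp, rfl⟩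
  have hdir : DirectedOn (· ≤ ·) d := by
    rintro _ ⟨t, ht, rfl⟩ _ ⟨t', ht', rfl⟩
    exact ⟨_, ⟨t ∪ t', by simp [ht, ht'], rfl⟩, Finset.sup_mono Finset.subset_union_left,
      Finset.sup_mono Finset.subset_union_right⟩
  have hlub : IsLUB d (⨆ i ∈ s, f i) := by
    constructor
    · rintro _ ⟨t, ht, rfl⟩
      exact Finset.sup_le fun i hi => le_iSup₂_of_le i (ht hi) le_rfl
    · intro b hb
      exact iSup₂_le fun i hi => hb ⟨{i}, by simpa using hi, by simp⟩
  obtain ⟨_, ⟨t, ht, rfl⟩, htW⟩ := hW'.2 (mem_univ _) hne hdir hlub h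
  exact ⟨t, ht, htW⟩

theorem WithScott.isUpperSet_of_isOpen {W : Set (WithScott α)} (hW : IsOpen W) {a b : α}
    (hab : a ≤ b) (ha : WithScott.toScott a ∈ W) : WithScott.toScott b ∈ W :=
  IsScott.isUpperSet_of_isOpen (D := univ) hW hab ha

theorem WithScott.isOpen_of_directed {W : Set (WithScott α)}
    (hup : ∀ a b : α, a ≤ b → WithScott.toScott a ∈ W → WithScott.toScott b ∈ W)
    (hdir : ∀ d : Set α, d.Nonempty → DirectedOn (· ≤ ·) d → WithScott.toScott (sSup d) ∈ W →
      ∃ b ∈ d, WithScott.toScott b ∈ W) : IsOpen W := by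
  refine (IsScott.isOpen_iff_isUpperSet_and_dirSupInaccOn (D := univ)).2
    ⟨fun a b => hup a b, fun d _ hne hd a ha haW => ?_⟩
  have h : a = sSup (α := α) d := IsLUB.unique (α := α) ha (isLUB_sSup _)
  subst h
  obtain ⟨b, hb, hbW⟩ := hdir d hne hd haW
  exact ⟨b, hb, hbW⟩

/-- In the Scott topology the saturated sets are the upper sets. -/
theorem WithScott.nhdsKer_eq_of_isUpperSet {W : Set (WithScott α)}
    (hup : ∀ a b : α, a ≤ b → WithScott.toScott a ∈ W → WithScott.toScott b ∈ W) :
    nhdsKer W = W := by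
  refine Subset.antisymm (fun a ha => ?_) subset_nhdsKer
  obtain ⟨b, hb, hab⟩ := mem_nhdsKer_iff_specializes.1 ha
  rw [specializes_iff_mem_closure, IsScott.closure_singleton] at hab
  exact hup b a hab hb

theorem WithScott.mem_nhdsKer_iff {W : Set (WithScott α)} {a : WithScott α} :
    a ∈ nhdsKer W ↔ ∃ b ∈ W, WithScott.ofScott b ≤ WithScott.ofScott a := by
  rw [mem_nhdsKer_iff_specializes]
  simp_rw [specializes_iff_mem_closure, IsScott.closure_singleton]
  rfl

section Selections

variable (F : ι → Finset α)

theorem preimage_iSup_eq_iUnion {W : Set (WithScott α)} (hW : IsOpen W) :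
    {s : ∀ i, F i | WithScott.toScott (⨆ i, (s i : α)) ∈ W} =
      ⋃ t : Finset ι, {s : ∀ i, F i | WithScott.toScott (t.sup fun i => (s i : α)) ∈ W} := by
  ext s
  simp only [mem_ofPred_eq, mem_iUnion]
  constructor
  · intro h
    obtain ⟨t, -, ht⟩ := hW.exists_finset_sup_mem (s := univ) (f := fun i => (s i : α))
      (by simpa using h)
    exact ⟨t, ht⟩
  · rintro ⟨t, ht⟩
    exact WithScott.isUpperSet_of_isOpen hW
      (Finset.sup_le fun i _ => le_iSup (fun i => (s i : α)) i) ht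

variable [∀ i, TopologicalSpace (F i)] [∀ i, DiscreteTopology (F i)]

theorem isOpen_setOf_finset_sup_mem {W : Set (WithScott α)} (t : Finset ι) :
    IsOpen {s : ∀ i, F i | WithScott.toScott (t.sup fun i => (s i : α)) ∈ W} := by
  refine isOpen_iff_forall_mem_open.2 fun s hs =>
    ⟨(t : Set ι).pi fun i => {s i}, fun s' hs' => ?_,
      isOpen_set_pi t.finite_toSet fun i _ => isOpen_discrete _, fun i _ => rfl⟩
  have : (t.sup fun i => (s' i : α)) = t.sup fun i => (s i : α) :=
    Finset.sup_congr rfl fun i hi => by rw [hs' i hi]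
  simpa only [mem_ofPred_eq, this] using hs

theorem continuous_iSup_selection :
    Continuous fun s : ∀ i, F i => WithScott.toScott (⨆ i, (s i : α)) :=
  continuous_def.2 fun W hW => by
    change IsOpen {s : ∀ i, F i | WithScott.toScott (⨆ i, (s i : α)) ∈ W}
    rw [preimage_iSup_eq_iUnion F hW]
    exact isOpen_iUnion fun t => isOpen_setOf_finset_sup_mem F t

end Selections

/-- An intersection of finitely generated upper sets is compact in the Scott topology: it is the
upper closure of the image of the compact space of selections `∏ i, F i` under the continuous map
that sends a selection to its supremum. -/
theorem isCompact_setOf_forall_exists_le (F : ι → Finset α) :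
    IsCompact {a : WithScott α | ∀ i, ∃ b ∈ F i, b ≤ WithScott.ofScott a} := by
  let _ : ∀ i, TopologicalSpace (F i) := fun _ => ⊥
  have _ : ∀ i, DiscreteTopology (F i) := fun _ => ⟨rfl⟩
  have h := (isCompact_range (continuous_iSup_selection F)).nhdsKer
  convert h using 1
  ext a
  rw [WithScott.mem_nhdsKer_iff]
  constructor
  · intro ha
    choose b hb hba using ha
    exact ⟨_, ⟨fun i => ⟨b i, hb i⟩, rfl⟩, iSup_le hba⟩
  · rintro ⟨_, ⟨s, rfl⟩, hs⟩ i
    exact ⟨s i, (s i).2, (le_iSup (fun i => (s i : α)) i).trans hs⟩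

/-- Well-filteredness for finitely generated upper sets: if their intersection lies in a Scott-open
set, so does the intersection of finitely many of them. -/
theorem exists_finset_setOf_forall_exists_le_subset (F : ι → Finset α) {W : Set (WithScott α)}
    (hW : IsOpen W) (h : ∀ a : α, (∀ i, ∃ b ∈ F i, b ≤ a) → WithScott.toScott a ∈ W) :
    ∃ t : Finset ι, ∀ a : α, (∀ i ∈ t, ∃ b ∈ F i, b ≤ a) → WithScott.toScott a ∈ W := by
  classical
  let _ : ∀ i, TopologicalSpace (F i) := fun _ => ⊥
  have _ : ∀ i, DiscreteTopology (F i) := fun _ => ⟨rfl⟩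
  by_cases hF : ∀ i, (F i).Nonempty
  swap
  · -- an empty `F i` already makes the intersection empty
    push Not at hF
    obtain ⟨i, hi⟩ := hF
    exact ⟨{i}, fun a ha => by simpa [hi] using ha i⟩
  obtain ⟨t, ht⟩ := isCompact_univ.elim_directed_cover
    (fun t : Finset ι => {s : ∀ i, F i | WithScott.toScott (t.sup fun i => (s i : α)) ∈ W})
    (fun t => isOpen_setOf_finset_sup_mem F t)
    (by
      rw [← preimage_iSup_eq_iUnion F hW]
      exact fun s _ => h _ fun i => ⟨s i, (s i).2, le_iSup (fun i => (s i : α)) i⟩)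
    (directed_of_isDirected_le fun t t' htt' s hs =>
      WithScott.isUpperSet_of_isOpen hW (Finset.sup_mono htt') hs)
  refine ⟨t, fun a ha => ?_⟩
  choose! b hb hba using ha
  -- extend the selection over `t` to all indices
  have hs := ht (mem_univ fun i => if hi : i ∈ t then ⟨b i, hb i hi⟩ else ⟨_, (hF i).choose_spec⟩)
  exact WithScott.isUpperSet_of_isOpen hW
    (Finset.sup_le fun i hi => by simpa [hi] using hba i hi) hs

end Scott

/-! ### Basic open sets of the lower powerspace -/

namespace LowerPowerspace

variable {X P : Type*} [TopologicalSpace X]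

@[simp]
theorem mem_diamond {U : Set X} {A : LowerPowerspace X} :
    A ∈ diamond U ↔ ((A : Set X) ∩ U).Nonempty := Iff.rfl

theorem isOpen_diamond {U : Set X} (hU : IsOpen U) : IsOpen (diamond U) :=
  isOpen_generateFrom_of_mem ⟨U, hU, rfl⟩

/-- The finite intersection `⋂ p ∈ F, ◇ (O p)`, as an open set of the lower powerspace. -/
def diamondInter (O : P → Opens X) (F : Finset P) : Opens (LowerPowerspace X) :=
  ⟨⋂ p ∈ F, diamond (O p), isOpen_biInter_finset fun p _ => isOpen_diamond (O p).isOpen⟩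

@[simp]
theorem mem_diamondInter {O : P → Opens X} {F : Finset P} {A : LowerPowerspace X} :
    A ∈ diamondInter O F ↔ ∀ p ∈ F, ((A : Set X) ∩ O p).Nonempty := by
  rw [← SetLike.mem_coe]
  simp [diamondInter]

theorem exists_diamondInter_le {𝒰 : Opens (LowerPowerspace X)} {A : LowerPowerspace X}
    (hA : A ∈ 𝒰) : ∃ F : Finset (Opens X), A ∈ diamondInter id F ∧ diamondInter id F ≤ 𝒰 := by
  classical
  obtain ⟨𝒰, h𝒰⟩ := 𝒰
  change TopologicalSpace.GenerateOpen _ 𝒰 at h𝒰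
  change A ∈ 𝒰 at hA
  suffices ∃ F : Finset (Opens X), A ∈ diamondInter id F ∧ (diamondInter id F : Set _) ⊆ 𝒰 from this
  induction h𝒰 with
  | basic _ h =>
    obtain ⟨U, hU, rfl⟩ := h
    exact ⟨{⟨U, hU⟩}, by simpa using hA, fun B hB => by simpa using hB⟩
  | univ => exact ⟨∅, by simp, subset_univ _⟩
  | inter _ _ _ _ h₁ h₂ =>
    obtain ⟨F₁, hF₁, hs₁⟩ := h₁ hA.1
    obtain ⟨F₂, hF₂, hs₂⟩ := h₂ hA.2
    refine ⟨F₁ ∪ F₂, ?_, fun B hB => ⟨hs₁ ?_, hs₂ ?_⟩⟩ <;>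
    simp only [SetLike.mem_coe, mem_diamondInter, Finset.mem_union] at * <;> grind
  | sUnion _ _ h =>
    obtain ⟨S, hS, hAS⟩ := hA
    obtain ⟨F, hF, hs⟩ := h S hS hAS
    exact ⟨F, hF, hs.trans (subset_sUnion_of_mem hS)⟩

/-- Open sets of the lower powerspace are upper sets for inclusion. -/
theorem mem_of_subset {𝒰 : Opens (LowerPowerspace X)} {A B : LowerPowerspace X} (hA : A ∈ 𝒰)
    (hAB : (A : Set X) ⊆ B) : B ∈ 𝒰 := by
  obtain ⟨F, hF, hs⟩ := exists_diamondInter_le hA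
  refine hs (mem_diamondInter.2 fun V hV => ?_)
  exact (mem_diamondInter.1 hF V hV).mono (inter_subset_inter_left _ hAB)

/-- The closure of `S`, as a point of the lower powerspace. -/
def ofClosure (S : Set X) : LowerPowerspace X := Closeds.closure S

theorem ofClosure_inter_nonempty {S : Set X} (U : Opens X) :
    ((ofClosure S : Set X) ∩ U).Nonempty ↔ (S ∩ U).Nonempty :=
  closure_inter_open_nonempty_iff U.isOpen

/-- A finite intersection of sets `◇ V` lies in `◇ U` only if a single `V` lies in `U`. -/
theorem diamondInter_subset_diamond {F : Finset (Opens X)} {U : Opens X} :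
    (diamondInter id F : Set (LowerPowerspace X)) ⊆ diamond U ↔ ∃ V ∈ F, V ≤ U := by
  constructor
  · intro h
    -- otherwise every `V ∈ F` meets the complement of `U`
    by_contra! hV
    have hx : ∀ V ∈ F, ∃ x ∈ V, x ∉ U := fun V hVF => SetLike.not_le_iff_exists.1 (hV V hVF)
    obtain ⟨x, hxA, hxU⟩ := (ofClosure_inter_nonempty U).1 <| h (a := ofClosure {x | x ∉ U}) <|
      mem_diamondInter.2 fun V hVF => (ofClosure_inter_nonempty V).2 <| by
        obtain ⟨x, hxV, hxU⟩ := hx V hVF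
        exact ⟨x, hxU, hxV⟩
    exact hxA hxU
  · rintro ⟨V, hV, hVU⟩ A hA
    exact (mem_diamondInter.1 hA V hV).mono (inter_subset_inter_right _ hVU)

end LowerPowerspace

/-! ### The values of `γ` -/

theorem IsCompact.isOpen_setOf_subset {X : Type*} [TopologicalSpace X] {K : Set X}
    (hK : IsCompact K) : IsOpen {U : OpenLattice X | K ⊆ U.toSet} := by
  refine WithScott.isOpen_of_directed (fun U V hUV (hU : K ⊆ U) => hU.trans hUV)
    fun d hne hd hKd => ?_
  have : Nonempty d := hne.to_subtype
  obtain ⟨U, hU⟩ := hK.elim_directed_cover (fun U : d => (U : Set X)) (fun U => U.1.isOpen)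
    (by
      intro x hx
      have := hKd hx
      change x ∈ sSup d at this
      simpa using this)
    (hd.directed_val)
  exact ⟨U, U.2, hU⟩

section

variable {X : Type*} [TopologicalSpace X]

/-- If each neighbourhood of `x` eventually fails to lie in `U n`, a diagonal choice gives points
outside `U n` converging to `x`. -/
theorem exists_tendsto_notMem [FirstCountableTopology X] {U : ℕ → Set X} {x : X}
    (h : ∀ V ∈ 𝓝 x, ∀ᶠ n in atTop, ¬ V ⊆ U n) :
    ∃ y : ℕ → X, Tendsto y atTop (𝓝 x) ∧ ∀ᶠ n in atTop, y n ∉ U n := by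
  classical
  obtain ⟨W, hW⟩ := (𝓝 x).exists_antitone_basis
  -- the index of the smallest basic neighbourhood known at stage `n` not to lie in `U n`
  let m : ℕ → ℕ := fun n => Nat.findGreatest (fun k => ¬ W k ⊆ U n) n
  have hm : ∀ k, ∀ᶠ n in atTop, k ≤ m n ∧ ¬ W (m n) ⊆ U n := fun k => by
    filter_upwards [eventually_ge_atTop k, h (W k) (hW.mem k)] with n hn hk
    exact ⟨Nat.le_findGreatest hn hk,
      Nat.findGreatest_spec (P := fun k => ¬ W k ⊆ U n) hn hk⟩
  have hy : ∀ n, ∃ y, ¬ W (m n) ⊆ U n → y ∈ W (m n) ∧ y ∉ U n := fun n => by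
    by_cases hn : W (m n) ⊆ U n
    · exact ⟨x, fun h => absurd hn h⟩
    · obtain ⟨y, hy⟩ := not_subset.1 hn
      exact ⟨y, fun _ => hy⟩
  choose y hy using hy
  refine ⟨y, hW.1.tendsto_right_iff.2 fun k _ => ?_, ?_⟩
  · filter_upwards [hm k] with n hn
    exact hW.2 hn.1 (hy n hn.2).1
  · filter_upwards [hm 0] with n hn
    exact (hy n hn.2).2

/-- The key to the openness of `⋂ U ∈ 𝔎, ◇ U`. If every member of a Scott-compact set `𝔎` of opens
meets `A`, then finitely many opens meeting `A` suffice to have one inside each member of `𝔎`.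
Otherwise there are `U n ∈ 𝔎` containing none of the first `n` basic opens meeting `A`; at a
cluster point `U` of these one finds a sequence of points outside `U n` converging to a point of
`A ∩ U`, and a tail of it with its limit is a compact subset of `U` contained in no `U n`. -/
theorem exists_finset_forall_exists_le [SecondCountableTopology X] {A : Set X}
    {𝔎 : Set (OpenLattice X)} (h𝔎 : IsCompact 𝔎) (hA : ∀ U ∈ 𝔎, (A ∩ U.toSet).Nonempty) :
    ∃ F : Finset (Opens X), (∀ V ∈ F, (A ∩ V).Nonempty) ∧
      ∀ U ∈ 𝔎, ∃ V ∈ F, V ≤ WithScott.ofScott U := by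
  classical
  obtain ⟨b, hbc, -, hb⟩ := TopologicalSpace.exists_countable_basis X
  let B : Set (Opens X) := {V | (V : Set X) ∈ b ∧ (A ∩ V).Nonempty}
  have hBc : B.Countable :=
    (hbc.preimage_of_injOn (f := fun V : Opens X => (V : Set X))
      SetLike.coe_injective.injOn).mono fun V hV => hV.1
  by_contra! hF
  obtain hB | hB := B.eq_empty_or_nonempty
  · obtain ⟨U, hU, -⟩ := hF ∅ (by simp)
    obtain ⟨x, hxA, hxU⟩ := hA U hU
    obtain ⟨V, hVb, hxV, -⟩ := hb.exists_subset_of_mem_open hxU (WithScott.ofScott U).isOpen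
    have : (⟨V, hb.isOpen hVb⟩ : Opens X) ∈ B := ⟨hVb, x, hxA, hxV⟩
    simp [hB] at this
  obtain ⟨V, hV⟩ := hBc.exists_eq_range hB
  have hU : ∀ n, ∃ U ∈ 𝔎, ∀ k ≤ n, ¬ V k ≤ WithScott.ofScott U := fun n => by
    obtain ⟨U, hU, h⟩ := hF ((Finset.range (n + 1)).image V) (by
      simp only [Finset.mem_image]
      rintro _ ⟨k, -, rfl⟩
      exact (hV ▸ mem_range_self k : V k ∈ B).2)
    exact ⟨U, hU, fun k hk =>
      h _ (Finset.mem_image_of_mem _ (Finset.mem_range.2 (Nat.lt_succ_of_le hk)))⟩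
  choose U hU𝔎 hUV using hU
  obtain ⟨W, hW𝔎, hW⟩ := h𝔎.exists_mapClusterPt_of_frequently (l := atTop) (f := U)
    (Frequently.of_forall hU𝔎)
  obtain ⟨x, hxA, hxW⟩ := hA W hW𝔎
  have hWo : IsOpen W.toSet := (WithScott.ofScott W).isOpen
  obtain ⟨y, hy, hyU⟩ := exists_tendsto_notMem (U := fun n => (U n).toSet) (x := x) fun N hN => by
    obtain ⟨V', hV'b, hxV', hV'N⟩ := hb.mem_nhds_iff.1 hN
    have : (⟨V', hb.isOpen hV'b⟩ : Opens X) ∈ B := ⟨hV'b, x, hxA, hxV'⟩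
    rw [hV] at this
    obtain ⟨k, hk⟩ := this
    filter_upwards [eventually_ge_atTop k] with n hn hNU
    refine hUV n k hn ?_
    rw [hk]
    exact hV'N.trans hNU
  obtain ⟨N, hN⟩ := eventually_atTop.1 (hyU.and (hy.eventually (hWo.mem_nhds hxW)))
  have hK : IsCompact (insert x (range fun n => y (n + N))) :=
    (hy.comp (tendsto_add_atTop_nat N)).isCompact_insert_range
  have hKW : insert x (range fun n => y (n + N)) ⊆ W.toSet := by
    rintro _ (rfl | ⟨n, rfl⟩)
    · exact hxW
    · exact (hN _ (by omega)).2
  obtain ⟨n, hnK, hn⟩ := ((hW.frequently (hK.isOpen_setOf_subset.mem_nhds hKW)).and_eventually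
    (eventually_ge_atTop N)).exists
  refine (hN n hn).1 (hnK (Or.inr ⟨n - N, ?_⟩))
  simp [Nat.sub_add_cancel hn]

end

/-! ### Convergent bases and consonance -/

/-- Kőnig's lemma for a sequence of finite nonempty levels `T n` and a relation `R` such that each
element of level `n + 1` is related to some element of level `n`. -/
theorem exists_seq_of_finset_levels {P : Type*} {R : P → P → Prop} (T : ℕ → Finset P)
    (hne : ∀ n, (T n).Nonempty) (hpar : ∀ n, ∀ q ∈ T (n + 1), ∃ p ∈ T n, R p q) :
    ∃ p : ℕ → P, (∀ n, p n ∈ T n) ∧ ∀ n, R (p n) (p (n + 1)) := by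
  choose! g hg hgR using hpar
  let π : ∀ n, T (n + 1) → T n := fun n q => ⟨g n q, hg n q q.2⟩
  let F := CategoryTheory.Functor.ofOpSequence (C := Type _)
    (X := fun n => T n) (fun n => TypeCat.ofHom (π n))
  have _ : ∀ j, Finite (F.obj j) := fun j => inferInstanceAs (Finite (T j.unop))
  have _ : ∀ j, Nonempty (F.obj j) := fun j => (hne j.unop).to_subtype
  obtain ⟨s, hs⟩ := nonempty_sections_of_finite_cofiltered_system F
  let t : ∀ n, T n := fun n => s (.op n)
  have ht : ∀ n, π n (t (n + 1)) = t n := fun n => by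
    have h := hs (CategoryTheory.homOfLE n.le_succ).op
    simp only [F, Nat.succ_eq_add_one, CategoryTheory.Functor.ofOpSequence_map_homOfLE_succ] at h
    exact h
  refine ⟨fun n => t n, fun n => (t n).2, fun n => ?_⟩
  change R (t n) (t (n + 1))
  rw [← ht n]
  exact hgR n _ (t (n + 1)).2

/-- A base `O` of a topology, indexed by codes `P`, with a refinement relation `R p q` ("`q` refines
`p`") for which every descending sequence of refinements shrinks to a point: some point has the
corresponding basic open sets as a neighbourhood base. -/
structure IsConvergentBase {X P : Type*} [TopologicalSpace X] (O : P → Opens X)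
    (R : P → P → Prop) : Prop where
  exists_mem_le : ∀ {x : X} {U : Opens X}, x ∈ U → ∃ p, x ∈ O p ∧ O p ≤ U
  anti : ∀ {p q : P}, R p q → O q ≤ O p
  exists_refine : ∀ {x : X} {p : P}, x ∈ O p → ∃ q, R p q ∧ x ∈ O q
  exists_limit : ∀ p : ℕ → P, (∀ n, R (p n) (p (n + 1))) →
    ∃ x, (∀ n, x ∈ O (p n)) ∧ ∀ U : Opens X, x ∈ U → ∃ n, O (p n) ≤ U

namespace IsConvergentBase

variable {X P : Type*} [TopologicalSpace X] {O : P → Opens X} {R : P → P → Prop}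

/-- A space with a convergent base is consonant: each Scott-open set of opens is a union of sets
`{V | K ⊆ V}` with `K` compact. Here `K` is the set of limits of the branches of a finitely
branching tree of refinements whose levels cover members of `W`. -/
theorem exists_isCompact (h : IsConvergentBase O R) {W : Set (OpenLattice X)} (hW : IsOpen W)
    {U : Opens X} (hU : WithScott.toScott U ∈ W) :
    ∃ K : Set X, IsCompact K ∧ K ⊆ U ∧ ∀ V : Opens X, K ⊆ V → WithScott.toScott V ∈ W := by
  classical
  obtain ⟨F₀, hF₀U, hF₀⟩ :
      ∃ F : Finset P, (∀ p ∈ F, O p ≤ U) ∧ WithScott.toScott (F.sup O) ∈ W := by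
    refine hW.exists_finset_sup_mem (s := {p | O p ≤ U})
      (WithScott.isUpperSet_of_isOpen hW (fun x hx => ?_) hU)
    obtain ⟨p, hxp, hp⟩ := h.exists_mem_le hx
    exact (le_iSup₂_of_le p hp le_rfl : O p ≤ _) hxp
  have hstep : ∀ F : {F : Finset P // WithScott.toScott (F.sup O) ∈ W},
      ∃ F' : {F : Finset P // WithScott.toScott (F.sup O) ∈ W}, ∀ q ∈ F'.1, ∃ p ∈ F.1, R p q := by
    rintro ⟨F, hF⟩
    obtain ⟨F', hF', hF'W⟩ := hW.exists_finset_sup_mem (s := {q | ∃ p ∈ F, R p q}) (f := O)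
      (WithScott.isUpperSet_of_isOpen hW (Finset.sup_le fun p hp x hx => by
        obtain ⟨q, hpq, hxq⟩ := h.exists_refine hx
        exact (le_iSup₂_of_le q ⟨p, hp, hpq⟩ le_rfl : O q ≤ _) hxq) hF)
    exact ⟨⟨F', hF'W⟩, fun q hq => hF' hq⟩
  choose next hnext using hstep
  let F : ℕ → {F : Finset P // WithScott.toScott (F.sup O) ∈ W} :=
    Nat.rec ⟨F₀, hF₀⟩ fun _ F => next F
  have hF : ∀ n, ∀ q ∈ (F (n + 1)).1, ∃ p ∈ (F n).1, R p q := fun n => hnext (F n)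
  let K : Set X := {x | ∃ p : ℕ → P, (∀ n, p n ∈ (F n).1) ∧ (∀ n, x ∈ O (p n)) ∧
    ∀ V : Opens X, x ∈ V → ∃ n, O (p n) ≤ V}
  -- some level of the tree refines any given open cover of `K`
  have hcover : ∀ S : Set (Opens X), (∀ x ∈ K, ∃ V ∈ S, x ∈ V) →
      ∃ n, ∀ q ∈ (F n).1, ∃ V ∈ S, O q ≤ V := by
    intro S hKS
    by_contra! hV
    obtain ⟨p, hpT, hpR⟩ := exists_seq_of_finset_levels (R := R)
      (fun n => (F n).1.filter fun q => ∀ V ∈ S, ¬ O q ≤ V)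
      (fun n => by
        obtain ⟨q, hq, hqV⟩ := hV n
        exact ⟨q, Finset.mem_filter.2 ⟨hq, hqV⟩⟩)
      (fun n q hq => by
        obtain ⟨hq, hqV⟩ := Finset.mem_filter.1 hq
        obtain ⟨p, hp, hpq⟩ := hF n q hq
        exact ⟨p, Finset.mem_filter.2 ⟨hp, fun V hVS hV => hqV V hVS ((h.anti hpq).trans hV)⟩, hpq⟩)
    obtain ⟨x, hx, hlim⟩ := h.exists_limit p hpR
    obtain ⟨V, hVS, hxV⟩ := hKS x ⟨p, fun n => (Finset.mem_filter.1 (hpT n)).1, hx, hlim⟩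
    obtain ⟨n, hn⟩ := hlim V hxV
    exact (Finset.mem_filter.1 (hpT n)).2 V hVS hn
  refine ⟨K, isCompact_of_finite_subcover fun {ι} V hVo hKV => ?_, ?_, fun V hKV => ?_⟩
  · obtain ⟨n, hn⟩ := hcover (range fun i => ⟨V i, hVo i⟩) fun x hx => by
      obtain ⟨i, hi⟩ := mem_iUnion.1 (hKV hx)
      exact ⟨_, ⟨i, rfl⟩, hi⟩
    simp only [exists_range_iff] at hn
    choose i hi using hn
    refine ⟨(F n).1.attach.image fun q => i q.1 q.2, ?_⟩
    rintro x ⟨p, hpF, hxp, -⟩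
    exact mem_biUnion (Finset.mem_image_of_mem _ (Finset.mem_attach _ ⟨p n, hpF n⟩))
      (hi _ (hpF n) (hxp n))
  · rintro x ⟨p, hpF, hxp, -⟩
    exact hF₀U _ (hpF 0) (hxp 0)
  · obtain ⟨n, hn⟩ := hcover {V} fun x hx => ⟨V, rfl, hKV hx⟩
    exact WithScott.isUpperSet_of_isOpen hW
      (Finset.sup_le fun q hq => by simpa using hn q hq) (F n).2

/-- Refinement of finite sets of codes, for the lower powerspace: each member of the first set is
refined by some member of the second. -/
def LowerRefines (R : P → P → Prop) (F G : Finset P) : Prop :=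
  ∀ p ∈ F, ∃ q ∈ G, R p q

open LowerPowerspace in
/-- The lower powerspace inherits a convergent base. A descending sequence of finite sets of codes
shrinks to the closure of the set of limits of its threads, where threads may start at any stage. -/
theorem lowerPowerspace (h : IsConvergentBase O R) :
    IsConvergentBase (diamondInter O) (LowerRefines R) := by
  classical
  have hanti : ∀ {F G : Finset P}, LowerRefines R F G → diamondInter O G ≤ diamondInter O F := by
    intro F G hFG A hA
    refine mem_diamondInter.2 fun p hp => ?_
    obtain ⟨q, hq, hpq⟩ := hFG p hp
    exact (mem_diamondInter.1 hA q hq).mono (inter_subset_inter_right _ (h.anti hpq))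
  refine ⟨fun {A 𝒰} hA => ?_, hanti, fun {A F} hA => ?_, fun F hF => ?_⟩
  · obtain ⟨G, hG, hG𝒰⟩ := exists_diamondInter_le hA
    have : ∀ V ∈ G, ∃ p, ((A : Set X) ∩ O p).Nonempty ∧ O p ≤ V := fun V hV => by
      obtain ⟨x, hxA, hxV⟩ := mem_diamondInter.1 hG V hV
      obtain ⟨p, hxp, hp⟩ := h.exists_mem_le hxV
      exact ⟨p, ⟨x, hxA, hxp⟩, hp⟩
    choose p hp hpV using this
    refine ⟨G.attach.image fun V : G => p V.1 V.2, mem_diamondInter.2 ?_, fun B hB => hG𝒰 ?_⟩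
    · simp only [Finset.mem_image]
      rintro _ ⟨V, -, rfl⟩
      exact hp V.1 V.2
    · refine mem_diamondInter.2 fun V hV => ?_
      exact (mem_diamondInter.1 hB _
        (Finset.mem_image_of_mem _ (Finset.mem_attach _ ⟨V, hV⟩))).mono
          (inter_subset_inter_right _ (hpV V hV))
  · have : ∀ p ∈ F, ∃ q, R p q ∧ ((A : Set X) ∩ O q).Nonempty := fun p hp => by
      obtain ⟨x, hxA, hxp⟩ := mem_diamondInter.1 hA p hp
      obtain ⟨q, hpq, hxq⟩ := h.exists_refine hxp
      exact ⟨q, hpq, x, hxA, hxq⟩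
    choose! q hq hqA using this
    exact ⟨F.image q, fun p hp => ⟨_, Finset.mem_image_of_mem q hp, hq p hp⟩,
      mem_diamondInter.2 (by simpa using hqA)⟩
  · let L : Set X := {x | ∃ (n : ℕ) (p : ℕ → P), (∀ k, p k ∈ F (n + k)) ∧ (∀ k, x ∈ O (p k)) ∧
      ∀ U : Opens X, x ∈ U → ∃ k, O (p k) ≤ U}
    refine ⟨ofClosure L, fun n => mem_diamondInter.2 fun p hp => ?_, fun 𝒰 h𝒰 => ?_⟩
    · choose! next hnext hnextR using hF
      let s : ∀ k, {q // q ∈ F (n + k)} :=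
        Nat.rec ⟨p, hp⟩ fun k q => ⟨next (n + k) q.1, hnext (n + k) q.1 q.2⟩
      obtain ⟨x, hx, hlim⟩ := h.exists_limit (fun k => (s k).1)
        fun k => hnextR (n + k) _ (s k).2
      exact (ofClosure_inter_nonempty _).2 ⟨x, ⟨n, _, fun k => (s k).2, hx, hlim⟩, hx 0⟩
    · obtain ⟨G, hG, hG𝒰⟩ := exists_diamondInter_le h𝒰
      have : ∀ V ∈ G, ∃ m, ∀ B ∈ diamondInter O (F m), ((B : Set X) ∩ V).Nonempty := by
        intro V hV
        obtain ⟨x, ⟨n, p, hpF, hxp, hlim⟩, hxV⟩ :=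
          (ofClosure_inter_nonempty V).1 (mem_diamondInter.1 hG V hV)
        obtain ⟨k, hk⟩ := hlim V hxV
        exact ⟨n + k, fun B hB => (mem_diamondInter.1 hB _ (hpF k)).mono
          (inter_subset_inter_right _ hk)⟩
      choose! m hm using this
      have hmono : Antitone fun n => diamondInter O (F n) :=
        antitone_nat_of_succ_le fun n => hanti (hF n)
      exact ⟨G.sup m, fun B hB => hG𝒰 <| mem_diamondInter.2 fun V hV =>
        hm V hV B (hmono (Finset.le_sup hV) hB)⟩

end IsConvergentBase

/-! ### Formal balls of a Smyth-complete quasi-metric -/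

section QuasiMetric

theorem IsQuasiMetric.self_eq_zero {X : Type*} {d : X → X → ℝ} (hd : IsQuasiMetric d) (x : X) :
    d x x = 0 :=
  ((hd.eq_iff x x).1 rfl).1

variable {X : Type*} [TopologicalSpace X] {d : X → X → ℝ}

/-- The triangle inequality makes the balls centred at `x` a neighbourhood base of `x`. -/
theorem IsQuasiMetric.exists_ball_subset (hd : IsQuasiMetric d)
    (ht : ‹TopologicalSpace X› =
      TopologicalSpace.generateFrom {B | ∃ (x : X) (ε : ℝ), 0 < ε ∧ B = {y | d x y < ε}})
    {U : Set X} (hU : IsOpen U) {x : X} (hx : x ∈ U) : ∃ ε > 0, {y | d x y < ε} ⊆ U := by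
  rw [ht] at hU
  change TopologicalSpace.GenerateOpen _ U at hU
  induction hU with
  | basic _ h =>
    obtain ⟨z, ε, -, rfl⟩ := h
    refine ⟨ε - d z x, sub_pos.2 hx, fun y (hy : d x y < ε - d z x) => ?_⟩
    have := hd.triangle z x y
    change d z y < ε
    linarith
  | univ => exact ⟨1, one_pos, subset_univ _⟩
  | inter _ _ _ _ h₁ h₂ =>
    obtain ⟨ε₁, hε₁, h₁⟩ := h₁ hx.1
    obtain ⟨ε₂, hε₂, h₂⟩ := h₂ hx.2
    exact ⟨min ε₁ ε₂, lt_min hε₁ hε₂, fun y (hy : d x y < min ε₁ ε₂) =>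
      ⟨h₁ (hy.trans_le (min_le_left _ _)), h₂ (hy.trans_le (min_le_right _ _))⟩⟩
  | sUnion _ _ h =>
    obtain ⟨S, hS, hxS⟩ := hx
    obtain ⟨ε, hε, h⟩ := h S hS hxS
    exact ⟨ε, hε, h.trans (subset_sUnion_of_mem hS)⟩

/-- Refinement of formal balls `(x, r)`: strict formal inclusion, with at most half the
radius, so that the radii tend to `0` along descending sequences. -/
def BallRefines (d : X → X → ℝ) (p q : X × {r : ℝ // 0 < r}) : Prop :=
  d p.1 q.1 + q.2 < p.2 ∧ (q.2 : ℝ) ≤ p.2 / 2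

/-- The balls of a Smyth-complete quasi-metric form a convergent base. The centres of a descending
sequence of formal balls form a Cauchy sequence, and its limit for the symmetrized metric is the
point to which the balls shrink. -/
theorem IsSmythComplete.exists_isConvergentBase (hd : IsQuasiMetric d) (hc : IsSmythComplete d)
    (ht : ‹TopologicalSpace X› =
      TopologicalSpace.generateFrom {B | ∃ (x : X) (ε : ℝ), 0 < ε ∧ B = {y | d x y < ε}}) :
    ∃ O : X × {r : ℝ // 0 < r} → Opens X, IsConvergentBase O (BallRefines d) := by
  have hball : ∀ (x : X) (r : ℝ), 0 < r → IsOpen {y | d x y < r} := fun x r hr => by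
    rw [ht]
    exact isOpen_generateFrom_of_mem ⟨x, r, hr, rfl⟩
  refine ⟨fun p => ⟨{y | d p.1 y < p.2}, hball _ _ p.2.2⟩, fun {x U} hx => ?_,
    fun {p q} hpq y (hy : d q.1 y < q.2) => ?_, fun {x p} (hx : d p.1 x < p.2) => ?_,
    fun p hp => ?_⟩
  · obtain ⟨ε, hε, h⟩ := hd.exists_ball_subset ht U.isOpen hx
    refine ⟨(x, ⟨ε, hε⟩), ?_, h⟩
    change d x x < ε
    rwa [hd.self_eq_zero]
  · have := hd.triangle p.1 q.1 y
    have := hpq.1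
    change d p.1 y < p.2
    linarith
  · have hp := p.2.2
    refine ⟨(x, ⟨min ((p.2 - d p.1 x) / 2) (p.2 / 2), by
      refine lt_min ?_ ?_ <;> linarith⟩), ⟨?_, min_le_right _ _⟩, ?_⟩
    · have := min_le_left (((p.2 : ℝ) - d p.1 x) / 2) (p.2 / 2)
      dsimp only
      linarith
    · change d x x < _
      rw [hd.self_eq_zero]
      exact Subtype.property _
  · let x : ℕ → X := fun n => (p n).1
    let r : ℕ → ℝ := fun n => (p n).2
    have hr : ∀ n, 0 < r n := fun n => (p n).2.2
    have hstep : ∀ n, d (x n) (x (n + 1)) + r (n + 1) < r n := fun n => (hp n).1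
    have hdist : ∀ n m, n ≤ m → d (x n) (x m) + r m ≤ r n := by
      intro n m hnm
      induction m, hnm using Nat.le_induction with
      | base => simp [hd.self_eq_zero]
      | succ m _ ih =>
        have := hd.triangle (x n) (x m) (x (m + 1))
        have := hstep m
        linarith
    have hrpow : ∀ n, r n ≤ r 0 * (1 / 2) ^ n := by
      intro n
      induction n with
      | zero => simp
      | succ n ih =>
        have : r (n + 1) ≤ r n / 2 := (hp n).2
        rw [pow_succ]
        linarith
    have hlim : Tendsto r atTop (𝓝 0) := by
      refine squeeze_zero (fun n => (hr n).le) hrpow ?_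
      simpa using (tendsto_pow_atTop_nhds_zero_of_lt_one (by norm_num : (0 : ℝ) ≤ 1 / 2)
        (by norm_num)).const_mul (r 0)
    have hsmall : ∀ ε > 0, ∃ N, ∀ n, N ≤ n → r n < ε := fun ε hε =>
      eventually_atTop.1 (hlim.eventually_lt_const hε)
    obtain ⟨z, hz⟩ := hc x fun ε hε => by
      obtain ⟨N, hN⟩ := hsmall ε hε
      refine ⟨N, fun n m hn hnm => ?_⟩
      have := hdist n m hnm
      have := hN n hn
      have := hr m
      linarith
    refine ⟨z, fun n => ?_, fun U hU => ?_⟩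
    · change d (x n) z < r n
      obtain ⟨N, hN⟩ := hz (r n - (d (x n) (x (n + 1)) + r (n + 1))) (sub_pos.2 (hstep n))
      have h₁ := (le_max_right _ _).trans_lt (hN (max N (n + 1)) (le_max_left _ _))
      have h₂ := hdist (n + 1) (max N (n + 1)) (le_max_right _ _)
      have h₃ := hd.triangle (x n) (x (n + 1)) z
      have h₄ := hd.triangle (x (n + 1)) (x (max N (n + 1))) z
      have := hr (max N (n + 1))
      linarith
    · obtain ⟨ε, hε, h⟩ := hd.exists_ball_subset ht U.isOpen hU
      obtain ⟨N, hN⟩ := hz (ε / 2) (half_pos hε)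
      obtain ⟨M, hM⟩ := hsmall (ε / 2) (half_pos hε)
      refine ⟨max N M, fun y (hy : d (x (max N M)) y < r (max N M)) => h ?_⟩
      have h₁ := (le_max_left _ _).trans_lt (hN (max N M) (le_max_left _ _))
      have h₂ := hM (max N M) (le_max_right _ _)
      have h₃ := hd.triangle z (x (max N M)) y
      change d z y < ε
      linarith

end QuasiMetric

/-! ### The homeomorphism -/

open LowerPowerspace

section Homeomorph

variable {X : Type*} [TopologicalSpace X]

theorem UpperPowerspace.isOpen_box {U : Set X} (hU : IsOpen U) : IsOpen (UpperPowerspace.box U) :=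
  isOpen_generateFrom_of_mem ⟨U, hU, rfl⟩

/-- A compact saturated set of opens is an upper set. -/
theorem UpperPowerspace.mem_of_le (𝔎 : UpperPowerspace (OpenLattice X)) {U V : OpenLattice X}
    (hU : U ∈ 𝔎) (hUV : WithScott.ofScott U ≤ WithScott.ofScott V) : V ∈ 𝔎 := by
  change V ∈ 𝔎.carrier
  rw [← 𝔎.saturated]
  exact WithScott.mem_nhdsKer_iff.2 ⟨U, hU, hUV⟩

/-- The map `γ`, which sends `𝔎` to `⋂ U ∈ 𝔎, ◇ U`. -/
def diamondInterOfUpper [SecondCountableTopology X] (𝔎 : UpperPowerspace (OpenLattice X)) :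
    OpenLattice (LowerPowerspace X) :=
  WithScott.toScott ⟨⋂ U ∈ 𝔎, diamond U.toSet, isOpen_iff_forall_mem_open.2 fun A hA => by
    obtain ⟨F, hF, hF𝔎⟩ := exists_finset_forall_exists_le 𝔎.isCompact (mem_iInter₂.1 hA)
    refine ⟨diamondInter id F, fun B hB => mem_iInter₂.2 fun U hU => ?_,
      (diamondInter id F).isOpen, mem_diamondInter.2 hF⟩
    exact diamondInter_subset_diamond.2 (hF𝔎 U hU) hB⟩

theorem mem_diamondInterOfUpper [SecondCountableTopology X]
    {𝔎 : UpperPowerspace (OpenLattice X)} {A : LowerPowerspace X} :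
    A ∈ (diamondInterOfUpper 𝔎).toSet ↔ ∀ U ∈ 𝔎, ((A : Set X) ∩ U.toSet).Nonempty :=
  mem_iInter₂

/-- This presents `δ 𝒰` as an intersection of finitely generated upper sets. -/
theorem subset_diamond_iff {𝒰 : Opens (LowerPowerspace X)} {U : Opens X} :
    (𝒰 : Set (LowerPowerspace X)) ⊆ diamond U ↔
      ∀ F : {F : Finset (Opens X) // diamondInter id F ≤ 𝒰}, ∃ V ∈ F.1, V ≤ U := by
  constructor
  · exact fun h F => diamondInter_subset_diamond.1 (subset_trans F.2 h)
  · intro h A hA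
    obtain ⟨F, hAF, hF⟩ := exists_diamondInter_le hA
    exact diamondInter_subset_diamond.2 (h ⟨F, hF⟩) hAF

/-- The map `δ`, which sends `𝒰` to the set of all `U` with `𝒰 ⊆ ◇ U`. -/
def upperOfOpen (𝒰 : OpenLattice (LowerPowerspace X)) : UpperPowerspace (OpenLattice X) where
  carrier := {U | 𝒰.toSet ⊆ diamond U.toSet}
  isCompact := by
    convert isCompact_setOf_forall_exists_le
      fun F : {F : Finset (Opens X) // diamondInter id F ≤ WithScott.ofScott 𝒰} => F.1 using 1
    ext U
    exact subset_diamond_iff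
  saturated := WithScott.nhdsKer_eq_of_isUpperSet fun U V hUV hU A hA =>
    (hU hA).mono (inter_subset_inter_right _ hUV)

theorem mem_upperOfOpen {𝒰 : OpenLattice (LowerPowerspace X)} {U : OpenLattice X} :
    U ∈ upperOfOpen 𝒰 ↔ 𝒰.toSet ⊆ diamond U.toSet := Iff.rfl

/-- Continuity of `δ` is an instance of well-filteredness: for a directed union `𝒰` of open sets,
`δ 𝒰` is the intersection of the finitely generated upper sets belonging to the basic open sets
below some member, and a Scott-open set containing it contains a finite subintersection. -/
theorem continuous_upperOfOpen :
    Continuous (upperOfOpen : OpenLattice (LowerPowerspace X) → _) := by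
  classical
  refine continuous_generateFrom_iff.2 ?_
  rintro _ ⟨W, hW, rfl⟩
  refine WithScott.isOpen_of_directed (fun 𝒰 𝒱 h𝒰𝒱 h𝒰 U hU =>
    h𝒰 (mem_upperOfOpen.2 fun A hA => mem_upperOfOpen.1 hU (h𝒰𝒱 hA))) ?_
  intro d hne hd hdW
  obtain ⟨t, ht⟩ := exists_finset_setOf_forall_exists_le_subset
    (fun F : {F : Finset (Opens X) // ∃ 𝒰 ∈ d, diamondInter id F ≤ 𝒰} => F.1) hW fun U hU => by
      refine hdW (mem_upperOfOpen.2 fun A hA => ?_)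
      obtain ⟨𝒰, h𝒰, hA⟩ := Opens.mem_sSup.1 hA
      obtain ⟨F, hAF, hF⟩ := exists_diamondInter_le hA
      exact diamondInter_subset_diamond.2 (hU ⟨F, 𝒰, h𝒰, hF⟩) hAF
  -- finitely many of the basic sets inside `⋃ d` already lie in a single member of `d`
  have : Nonempty d := hne.to_subtype
  choose g hgd hg using fun F : {F : Finset (Opens X) // ∃ 𝒰 ∈ d, diamondInter id F ≤ 𝒰} => F.2
  obtain ⟨𝒰, h𝒰⟩ := Directed.finset_le hd.directed_val (t.image fun F => (⟨g F, hgd F⟩ : d))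
  refine ⟨𝒰, 𝒰.2, fun U hU => ht _ fun F hF => ?_⟩
  refine diamondInter_subset_diamond.1 (subset_trans (hg F) ?_)
  exact subset_trans (h𝒰 _ (Finset.mem_image_of_mem _ hF)) hU

/-- Continuity of `γ` is consonance of the lower powerspace: a Scott-open condition on `γ 𝔎`
follows from the inclusion of a compact set `C`, and `C ⊆ γ 𝔎` means that `𝔎` lies in the
Scott-open set of all `U` with `C ⊆ ◇ U`. -/
theorem continuous_diamondInterOfUpper [QuasiPolishSpace X] :
    Continuous (diamondInterOfUpper : UpperPowerspace (OpenLattice X) → _) := by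
  obtain ⟨d, hd, hc, ht⟩ := QuasiPolishSpace.exists_quasiMetric (X := X)
  obtain ⟨O, hO⟩ := IsSmythComplete.exists_isConvergentBase hd hc ht
  refine continuous_def.2 fun W hW => isOpen_iff_forall_mem_open.2 fun 𝔎 h𝔎 => ?_
  obtain ⟨C, hC, hC𝔎, hCW⟩ := hO.lowerPowerspace.exists_isCompact hW h𝔎
  refine ⟨UpperPowerspace.box {U | C ⊆ diamond U.toSet}, fun 𝔏 h𝔏 => hCW _ fun A hA => ?_,
    UpperPowerspace.isOpen_box ?_, fun U hU A hA => ?_⟩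
  · exact mem_diamondInterOfUpper.2 fun U hU => h𝔏 hU hA
  · refine WithScott.isOpen_of_directed
      (fun U V hUV hU A hA => (hU hA).mono (inter_subset_inter_right _ hUV)) fun D hne hD hCD => ?_
    have : Nonempty D := hne.to_subtype
    obtain ⟨U, hU⟩ := hC.elim_directed_cover (fun U : D => diamond (U : Set X))
      (fun U => isOpen_diamond U.1.isOpen)
      (fun A hA => by
        obtain ⟨x, hxA, hx⟩ := hCD hA
        obtain ⟨U, hU, hxU⟩ := Opens.mem_sSup.1 hx
        exact mem_iUnion.2 ⟨⟨U, hU⟩, x, hxA, hxU⟩)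
      (fun U V => by
        obtain ⟨W, hUW, hVW⟩ := hD.directed_val U V
        exact ⟨W, fun A hA => hA.mono (inter_subset_inter_right _ hUW),
          fun A hA => hA.mono (inter_subset_inter_right _ hVW)⟩)
    exact ⟨U, U.2, hU⟩
  · exact mem_diamondInterOfUpper.1 (hC𝔎 hA) U hU

variable (X) in
/-- The homeomorphism `γ` with inverse `δ`. Both compositions are identities because an upper set
of opens, and an open set of closed sets, can be tested against complements. -/
def upperOpenHomeomorph [QuasiPolishSpace X] :
    UpperPowerspace (OpenLattice X) ≃ₜ OpenLattice (LowerPowerspace X) where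
  toFun := diamondInterOfUpper
  invFun := upperOfOpen
  left_inv 𝔎 := by
    refine SetLike.ext fun U => ⟨fun hU => ?_, fun hU A hA => mem_diamondInterOfUpper.1 hA U hU⟩
    by_contra hU𝔎
    obtain ⟨x, hxU, hx⟩ := hU (a := (WithScott.ofScott U).compl) <|
      mem_diamondInterOfUpper.2 fun V hV => by
        obtain ⟨x, hxV, hxU⟩ := SetLike.not_le_iff_exists.1 fun h => hU𝔎 (𝔎.mem_of_le hV h)
        exact ⟨x, hxU, hxV⟩
    exact hxU hx
  right_inv 𝒰 := by
    refine Opens.ext (Subset.antisymm (fun A hA => ?_) fun A hA =>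
      mem_diamondInterOfUpper.2 fun U hU => hU hA)
    by_contra hA𝒰
    obtain ⟨x, hxA, hx⟩ := mem_diamondInterOfUpper.1 hA (WithScott.toScott (Closeds.compl A))
      fun B hB => by
        obtain ⟨x, hxB, hxA⟩ := not_subset.1 fun h => hA𝒰 (mem_of_subset hB h)
        exact ⟨x, hxB, hxA⟩
    exact hx hxA
  continuous_toFun := continuous_diamondInterOfUpper
  continuous_invFun := continuous_upperOfOpen

theorem upperOpenHomeomorph_map {Y : Type*} [TopologicalSpace Y] [QuasiPolishSpace X]
    [QuasiPolishSpace Y] (f : C(X, Y)) (𝔎 : UpperPowerspace (OpenLattice Y)) :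
    upperOpenHomeomorph X (UpperPowerspace.map (OpenLattice.map f) 𝔎) =
      OpenLattice.map (LowerPowerspace.map f) (upperOpenHomeomorph Y 𝔎) := by
  refine Opens.ext (Set.ext fun A => ?_)
  have hA : ∀ U : OpenLattice Y, (((LowerPowerspace.map f A : LowerPowerspace Y) : Set Y) ∩
      U.toSet).Nonempty ↔ ((A : Set X) ∩ (OpenLattice.map f U).toSet).Nonempty := fun U =>
    (ofClosure_inter_nonempty (WithScott.ofScott U)).trans image_inter_nonempty_iff
  refine mem_diamondInterOfUpper.trans (Iff.trans ?_ (Iff.symm mem_diamondInterOfUpper))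
  simp only [hA]
  constructor
  · exact fun h U hU => h _ (subset_nhdsKer (mem_image_of_mem _ hU))
  · intro h V hV
    obtain ⟨_, ⟨U, hU, rfl⟩, hUV⟩ := WithScott.mem_nhdsKer_iff.1 hV
    exact (h U hU).mono (inter_subset_inter_right _ hUV)

end Homeomorph

theorem mainTheorem4 :
    ∃ γ : ∀ (X : Type u) [TopologicalSpace X] [QuasiPolishSpace X],
        UpperPowerspace (OpenLattice X) ≃ₜ OpenLattice (LowerPowerspace X),
      -- the values of `γ_X` and of its inverse `δ_X`
      (∀ (X : Type u) [TopologicalSpace X] [QuasiPolishSpace X],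
        (∀ 𝔎 : UpperPowerspace (OpenLattice X),
          (γ X 𝔎).toSet = ⋂ U ∈ 𝔎, LowerPowerspace.diamond U.toSet) ∧
        (∀ 𝒰 : OpenLattice (LowerPowerspace X),
          ((γ X).symm 𝒰 : Set (OpenLattice X)) =
            {U | 𝒰.toSet ⊆ LowerPowerspace.diamond U.toSet})) ∧
      -- naturality of `γ` and `δ`
      (∀ (X Y : Type u) [TopologicalSpace X] [QuasiPolishSpace X]
          [TopologicalSpace Y] [QuasiPolishSpace Y] (f : C(X, Y)),
        (∀ 𝔎 : UpperPowerspace (OpenLattice Y),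
          γ X (UpperPowerspace.map (OpenLattice.map f) 𝔎) =
            OpenLattice.map (LowerPowerspace.map f) (γ Y 𝔎)) ∧
        (∀ 𝒰 : OpenLattice (LowerPowerspace Y),
          (γ X).symm (OpenLattice.map (LowerPowerspace.map f) 𝒰) =
            UpperPowerspace.map (OpenLattice.map f) ((γ Y).symm 𝒰))) := by
  refine ⟨fun X _ _ => upperOpenHomeomorph X, fun X _ _ => ⟨fun _ => rfl, fun _ => rfl⟩,
    fun X Y _ _ _ _ f => ⟨upperOpenHomeomorph_map f, fun 𝒰 => ?_⟩⟩
  rw [Homeomorph.symm_apply_eq, upperOpenHomeomorph_map, Homeomorph.apply_symm_apply]
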